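/- Let $(\Omega,\mathcal F,\mathrm p)$ be a probability space, let $d\in\mathbb N$, and let $\|\cdot\|$ denote the Euclidean norm on $\mathbb C^d$ and the corresponding operator norm; inner products are linear in the second factor. Let $M:\Omega\to M_d(\mathbb C)$ be a measurable random matrix such that (1) there is a norm $|||\cdot|||$ on $\mathbb C^d$, independent of $\omega$, with $|||M(\omega)x|||\le|||x|||$ for all $\omega\in\Omega$ and $x\in\mathbb C^d$; (2) there is a vector $\psi_S\in\mathbb C^d$, independent of $\omega$, with $\|\psi_S\|=1$ and $M(\omega)\psi_S=\psi_S$ for all $\omega\in\Omega$. Let $P_1(\omega)$ be the spectral projection of $M(\omega)$ for the eigenvalue $1$, and put $\psi(\omega)=P_1(\omega)^*\psi_S$, $P(\omega)=|\psi_S\rangle\langle\psi(\omega)|$, $Q(\omega)=1-P(\omega)$ and $M_Q(\omega)=Q(\omega)M(\omega)Q(\omega)$. Let $\mathbb P=\bigotimes_{j\ge1}\mathrm p$ be the product measure on $\Omega^{\mathbb N^*}$, $\mathbb N^*=\{1,2,\dots\}$, write $\overline\omega=(\omega_1,\omega_2,\dots)$, let $\mathbb E$ be the expectation with respect to $\mathrm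 p$, and for $n\ge1$ set $$\theta_n(\overline\omega)=M(\omega_n)^*M(\omega_{n-1})^*\cdots M(\omega_2)^*\psi(\omega_1).$$ Assume condition (RE): there are constants $C,\alpha>0$ such that, for $\mathbb P$-almost every $\overline\omega$, there is $n_0(\overline\omega)\in\mathbb N$ such that, for all $n\ge1$, $\|M_Q(\omega_1)\cdots M_Q(\omega_n)\|\le Ce^{-\alpha n}$ if $n\ge n_0(\overline\omega)$, and $\|M_Q(\omega_1)\cdots M_Q(\omega_n)\|\le C$ otherwise. Then $\psi$ and $M_Q^*$ are integrable, $1-\mathbb E[M_Q^*]$ is invertible, and for $\mathbb P$-almost every $\overline\omega$ $$\lim_{N\to\infty}\frac1N\sum_{n=1}^N\theta_n(\overline\omega)=\theta,\qquad \theta:=\bigl(1-\mathbb E[M_Q^*]\bigr)^{-1}\mathbb E[\psi].$$ -/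

import Mathlib

open MeasureTheory Filter Topology

noncomputable section

namespace RRDO

/-- `ℂ^d` with the Euclidean norm and inner product. -/
abbrev V (d : ℕ) : Type := EuclideanSpace ℂ (Fin d)

/-- Complex `d × d` matrices, as operators on `ℂ^d`, with the Euclidean operator norm. -/
abbrev Op (d : ℕ) : Type := V d →L[ℂ] V d

variable {d : ℕ} {Ω : Type*}

/-- `M` is a random reduced dynamics operator with normalized invariant vector `ψS`: a measurable
random matrix, contractive for all `ω` with respect to one norm on `ℂ^d` (a seminorm that
separates points), which fixes the deterministic unit vector `ψS`. -/
structure IsRRDO [MeasurableSpace Ω] (M : Ω → Op d) (ψS : V d) : Prop where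
  measurable : Measurable M
  contraction : ∃ ν : Seminorm ℂ (V d), (∀ x, ν x = 0 → x = 0) ∧ ∀ ω x, ν (M ω x) ≤ ν x
  invariant : ∀ ω, M ω ψS = ψS
  norm_eq_one : ‖ψS‖ = 1

/-- The spectral (Riesz) projection of `A` for the spectral value `1`: the projection onto the
generalized eigenspace `⋃ₙ ker (A - 1)ⁿ` along the complementary `A`-invariant subspace
`⋂ₙ ran (A - 1)ⁿ`, which is the sum of all the other generalized eigenspaces. -/
def spectralProjOne (A : Op d) : Op d :=
  LinearMap.toContinuousLinearMap
    (Submodule.projection _ _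
      (LinearMap.isCompl_iSup_ker_pow_iInf_range_pow ((A - 1 : Op d) : V d →ₗ[ℂ] V d)))

/-- `ψ(ω) = P₁(ω)^* ψS`. -/
def psi (M : Ω → Op d) (ψS : V d) (ω : Ω) : V d :=
  ContinuousLinearMap.adjoint (spectralProjOne (M ω)) ψS

/-- `P(ω) = |ψS⟩⟨ψ(ω)|`, that is `x ↦ ⟨ψ(ω), x⟩ ψS`. -/
def projP (M : Ω → Op d) (ψS : V d) (ω : Ω) : Op d :=
  InnerProductSpace.rankOne ℂ ψS (psi M ψS ω)

/-- `M_Q(ω) = Q(ω) M(ω) Q(ω)` with `Q(ω) = 1 - P(ω)`. -/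
def MQ (M : Ω → Op d) (ψS : V d) (ω : Ω) : Op d :=
  (1 - projP M ψS ω) * M ω * (1 - projP M ψS ω)

/-- The product `M_Q(ω₁) ⋯ M_Q(ωₙ)`. A point `(ω₁, ω₂, …)` is a sequence `w : ℕ → Ω`
with `w j = ω_{j+1}`. -/
def prodMQ (M : Ω → Op d) (ψS : V d) (n : ℕ) (w : ℕ → Ω) : Op d :=
  (List.ofFn fun i : Fin n => MQ M ψS (w i)).prod

/-- The process `θₙ = M(ωₙ)^* ⋯ M(ω₂)^* ψ(ω₁)` for `n ≥ 1`; the value at `n = 0` is not used.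
As above, `w j = ω_{j+1}`. -/
def theta (M : Ω → Op d) (ψS : V d) (w : ℕ → Ω) : ℕ → V d
  | 0 => 0
  | 1 => psi M ψS (w 0)
  | n + 2 => ContinuousLinearMap.adjoint (M (w (n + 1))) (theta M ψS w (n + 1))

/-- The i.i.d. product measure on `Ω^{ℕ^*}`. -/
def iidMeasure [MeasurableSpace Ω] (p : Measure Ω) : Measure (ℕ → Ω) :=
  Measure.infinitePi fun _ => p

/-- Condition (RE): there are deterministic `C, α > 0` such that almost surely, for some random
`n₀`, one has `‖M_Q(ω₁) ⋯ M_Q(ωₙ)‖ ≤ C e^{-α n}` if `n ≥ n₀`, and `≤ C` otherwise. -/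
def CondRE [MeasurableSpace Ω] (p : Measure Ω) (M : Ω → Op d) (ψS : V d) : Prop :=
  ∃ C > (0 : ℝ), ∃ α > (0 : ℝ), ∀ᵐ w ∂(iidMeasure p), ∃ n₀ : ℕ, ∀ n : ℕ, 1 ≤ n →
    (n₀ ≤ n → ‖prodMQ M ψS n w‖ ≤ C * Real.exp (-α * n)) ∧
    (n < n₀ → ‖prodMQ M ψS n w‖ ≤ C)

/-- The mean `E[M_Q^*]`. -/
def meanMQAdj [MeasurableSpace Ω] (p : Measure Ω) (M : Ω → Op d) (ψS : V d) : Op d :=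
  ∫ ω, ContinuousLinearMap.adjoint (MQ M ψS ω) ∂p

/-- The limit vector `θ = (1 - E[M_Q^*])⁻¹ E[ψ]`. -/
def thetaLim [MeasurableSpace Ω] (p : Measure Ω) (M : Ω → Op d) (ψS : V d) : V d :=
  Ring.inverse (1 - meanMQAdj p M ψS) (∫ ω, psi M ψS ω ∂p)

end RRDO

end

/-! ### Power-bounded operators and their spectral projection at 1. -/

namespace RRDO

/-! The contraction norm makes every `M ω` power-bounded, uniformly in `ω`, so the eigenvalue 1 is
semisimple and its spectral projection is the limit of the Cesàro means of the powers. This makes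
`psi` bounded, measurable and invariant under the adjoint of `M ω`, so `MQ` is `M` minus a rank-one
term. As `⟨ψS, θₙ⟩ = 1`, the process obeys the affine recursion `θₙ₊₁ = M_Q(ωₙ₊₁)^* θₙ + ψ(ωₙ₊₁)`
(`IsRRDO.theta_succ`).

Put `B = E[M_Q^*]` and `b = E[ψ]`. Since `θₙ` depends only on the first `n` coordinates, `θₙ₊₁ - B
θₙ - b` is a bounded martingale difference, and its averages vanish almost surely by an L² strong
law (`ae_tendsto_average_of_orthogonal`). Summing the recursion gives `(1 - B) ∑ θₙ = N b + o(N)`.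

To invert `1 - B`: by independence `Bⁿ x` is the mean of `M_Q(ωₙ)^* ⋯ M_Q(ω₁)^* x`, which tends to 0
by (RE) and dominated convergence. So `B` fixes no nonzero vector, which suffices in finite
dimension. -/

theorem exists_seminorm_equiv {E : Type*} [NormedAddCommGroup E] [NormedSpace ℂ E]
    [FiniteDimensional ℂ E] (ν : Seminorm ℂ E) (hν : ∀ x, ν x = 0 → x = 0) :
    ∃ a > (0 : ℝ), ∃ b > (0 : ℝ), ∀ x, ‖x‖ ≤ a * ν x ∧ ν x ≤ b * ‖x‖ := by
  have : FiniteDimensional ℝ E := FiniteDimensional.complexToReal E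
  have : ProperSpace E := FiniteDimensional.proper ℂ E
  have hc : Continuous ν := by
    have : ConvexOn ℝ Set.univ ν := ν.convexOn
    exact this.locallyLipschitz.continuous
  rcases subsingleton_or_nontrivial E with hE | hE
  · refine ⟨1, one_pos, 1, one_pos, fun x => ?_⟩
    simp [Subsingleton.elim x 0]
  have hK : IsCompact (Metric.sphere (0 : E) 1) := isCompact_sphere 0 1
  have hne : (Metric.sphere (0 : E) 1).Nonempty := by
    obtain ⟨x, hx⟩ := exists_ne (0 : E)
    refine ⟨((‖x‖ : ℂ)⁻¹) • x, ?_⟩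
    have : ‖x‖ ≠ 0 := norm_ne_zero_iff.2 hx
    simp [norm_smul, this]
  obtain ⟨u, hu, hmin⟩ := hK.exists_isMinOn hne hc.continuousOn
  obtain ⟨v, hv, hmax⟩ := hK.exists_isMaxOn hne hc.continuousOn
  have hpos : ∀ y ∈ Metric.sphere (0 : E) 1, 0 < ν y := fun y hy =>
    lt_of_le_of_ne (apply_nonneg ν y) fun h => by
      have : y = 0 := hν y h.symm
      simp [this] at hy
  -- The constants come from the minimum and the maximum of `ν` on the unit sphere.
  refine ⟨(ν u)⁻¹, inv_pos.2 (hpos u hu), ν v, hpos v hv, fun x => ?_⟩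
  by_cases hx : x = 0
  · simp [hx]
  have hx0 : 0 < ‖x‖ := norm_pos_iff.2 hx
  have hmem : ((‖x‖ : ℂ)⁻¹) • x ∈ Metric.sphere (0 : E) 1 := by
    simp [norm_smul, hx0.ne']
  have h1 : ν u ≤ ν (((‖x‖ : ℂ)⁻¹) • x) := hmin hmem
  have h2 : ν (((‖x‖ : ℂ)⁻¹) • x) ≤ ν v := hmax hmem
  have h3 : ν (((‖x‖ : ℂ)⁻¹) • x) = ν x / ‖x‖ := by
    rw [map_smul_eq_mul, norm_inv, Complex.norm_real, norm_norm]; field_simp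
  rw [h3] at h1 h2
  rw [le_div_iff₀ hx0] at h1
  rw [div_le_iff₀ hx0] at h2
  exact ⟨by rw [inv_mul_eq_div, le_div_iff₀ (hpos u hu)]; linarith, h2⟩

variable {d : ℕ}

theorem spectralProjOne_apply (A : Op d) (x : V d) :
    spectralProjOne A x = Submodule.projection _ _
      (LinearMap.isCompl_iSup_ker_pow_iInf_range_pow ((A - 1 : Op d) : V d →ₗ[ℂ] V d)) x := rfl

theorem pow_apply_of_sub_fixed {A : Op d} {x y : V d} (hx : A x = x + y) (hy : A y = y) (n : ℕ) :
    (A ^ n) x = x + (n : ℂ) • y := by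
  induction n with
  | zero => simp
  | succ n ih =>
    rw [pow_succ', mul_apply_eq_comp, ih, map_add, map_smul, hx, hy]
    push_cast
    module

/-- A Jordan chain of length two at 1 would make `Aⁿ x = x + n y` grow linearly, against
power-boundedness. -/
theorem fixed_of_sub_fixed {A : Op d} {K : ℝ} (hA : ∀ n x, ‖(A ^ n) x‖ ≤ K * ‖x‖) {x y : V d}
    (hx : A x = x + y) (hy : A y = y) : y = 0 := by
  by_contra h
  have hy0 : 0 < ‖y‖ := norm_pos_iff.2 h
  obtain ⟨n, hn⟩ := exists_nat_gt ((K * ‖x‖ + ‖x‖) / ‖y‖)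
  rw [div_lt_iff₀ hy0] at hn
  have h1 := hA n x
  rw [pow_apply_of_sub_fixed hx hy] at h1
  have h2 : ‖(n : ℂ) • y‖ ≤ ‖x + (n : ℂ) • y‖ + ‖x‖ := by
    simpa using norm_sub_le (x + (n : ℂ) • y) x
  rw [norm_smul, Complex.norm_natCast] at h2
  linarith

theorem ker_pow_le_ker {A : Op d} {K : ℝ} (hA : ∀ n x, ‖(A ^ n) x‖ ≤ K * ‖x‖) (n : ℕ) (x : V d)
    (hx : ((((A - 1 : Op d) : V d →ₗ[ℂ] V d)) ^ n) x = 0) : A x = x := by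
  induction n generalizing x with
  | zero => simp_all
  | succ n ih =>
    rw [pow_succ, Module.End.mul_apply] at hx
    have h1 := ih _ hx
    have := fixed_of_sub_fixed hA (x := x) (y := A x - x) (by simp) (by simpa using h1)
    exact sub_eq_zero.1 this

theorem spectralProjOne_fixed {A : Op d} {K : ℝ} (hA : ∀ n x, ‖(A ^ n) x‖ ≤ K * ‖x‖) (x : V d) :
    A (spectralProjOne A x) = spectralProjOne A x := by
  have h : spectralProjOne A x ∈ ⨆ n, LinearMap.ker ((((A - 1 : Op d) : V d →ₗ[ℂ] V d)) ^ n) :=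
    Submodule.projection_apply_mem _ _
  rw [Submodule.mem_iSup_of_directed] at h
  · obtain ⟨n, hn⟩ := h
    exact ker_pow_le_ker hA n _ hn
  · exact Monotone.directed_le ((((A - 1 : Op d) : V d →ₗ[ℂ] V d)).iterateKer).monotone

theorem spectralProjOne_of_fixed {A : Op d} {x : V d} (hx : A x = x) :
    spectralProjOne A x = x := by
  rw [spectralProjOne_apply]
  apply Submodule.projection_apply_of_mem_left
  apply Submodule.mem_iSup_of_mem 1
  simp [hx]

theorem exists_sub_eq_sub_spectralProjOne (A : Op d) (x : V d) :
    ∃ y, A y - y = x - spectralProjOne A x := by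
  have h := Submodule.sub_projection_mem
    (LinearMap.isCompl_iSup_ker_pow_iInf_range_pow ((A - 1 : Op d) : V d →ₗ[ℂ] V d)) x
  rw [← spectralProjOne_apply, Submodule.mem_iInf] at h
  obtain ⟨y, hy⟩ := h 1
  exact ⟨y, by simpa using hy⟩

theorem spectralProjOne_apply_image {A : Op d} {K : ℝ} (hA : ∀ n x, ‖(A ^ n) x‖ ≤ K * ‖x‖)
    (x : V d) : spectralProjOne A (A x) = spectralProjOne A x := by
  rw [← sub_eq_zero, ← map_sub]
  have h := Submodule.sub_projection_mem
    (LinearMap.isCompl_iSup_ker_pow_iInf_range_pow ((A - 1 : Op d) : V d →ₗ[ℂ] V d)) x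
  -- The component in the eigenspace cancels, and `⋂ₙ ran (A - 1)ⁿ`, which holds the other
  -- component, is stable under `A - 1`.
  have hx : A x - x = (A - 1 : Op d) (x - spectralProjOne A x) := by
    have := spectralProjOne_fixed hA x
    simp [this]
  rw [spectralProjOne_apply]
  apply Submodule.projection_apply_of_mem_right
  rw [hx]
  rw [← spectralProjOne_apply, Submodule.mem_iInf] at h
  rw [Submodule.mem_iInf]
  intro n
  obtain ⟨u, hu⟩ := h n
  refine ⟨(A - 1 : Op d) u, ?_⟩
  rw [← hu, ← ContinuousLinearMap.coe_coe (A - 1), ← Module.End.mul_apply,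
    ← Module.End.mul_apply, (Commute.pow_self _ n).eq]

/-- Mean ergodic theorem: `x` is a fixed vector plus a coboundary `A y - y`, whose powers telescope
to a bounded remainder. It yields both the norm bound on the projection and its measurability in
`ω`. -/
theorem tendsto_cesaro_spectralProjOne {A : Op d} {K : ℝ} (hA : ∀ n x, ‖(A ^ n) x‖ ≤ K * ‖x‖)
    (x : V d) :
    Tendsto (fun N : ℕ => (N : ℝ)⁻¹ • ∑ k ∈ Finset.range N, (A ^ k) x) atTop
      (𝓝 (spectralProjOne A x)) := by
  obtain ⟨y, hy⟩ := exists_sub_eq_sub_spectralProjOne A x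
  have hfix : ∀ k : ℕ, (A ^ k) (spectralProjOne A x) = spectralProjOne A x := fun k => by
    rw [pow_apply_of_sub_fixed (y := 0) (by simpa using spectralProjOne_fixed hA x) (by simp)]
    simp
  have hsum : ∀ N : ℕ, ∑ k ∈ Finset.range N, (A ^ k) x
      = (N : ℝ) • spectralProjOne A x + ((A ^ N) y - y) := fun N => by
    induction N with
    | zero => simp
    | succ N ih =>
      have hx : x = spectralProjOne A x + (A y - y) := by rw [hy]; abel
      have : (A ^ N) x = spectralProjOne A x + ((A ^ (N + 1)) y - (A ^ N) y) := by
        conv_lhs => rw [hx]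
        rw [map_add, map_sub, hfix, pow_succ, mul_apply_eq_comp]
      rw [Finset.sum_range_succ, ih, this]
      push_cast
      module
  have h0 : Tendsto (fun N : ℕ => (N : ℝ)⁻¹ • ((A ^ N) y - y)) atTop (𝓝 0) := by
    apply squeeze_zero_norm (a := fun N : ℕ => (N : ℝ)⁻¹ * (K * ‖y‖ + ‖y‖))
    · intro N
      rw [norm_smul, norm_inv, Real.norm_natCast]
      gcongr
      exact (norm_sub_le _ _).trans (by gcongr; exact hA N y)
    · simpa using (tendsto_inv_atTop_nhds_zero_nat (𝕜 := ℝ)).mul_const (K * ‖y‖ + ‖y‖)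
  have h1 : Tendsto (fun N : ℕ => spectralProjOne A x + (N : ℝ)⁻¹ • ((A ^ N) y - y)) atTop
      (𝓝 (spectralProjOne A x)) := by simpa using h0.const_add (spectralProjOne A x)
  refine h1.congr' ?_
  filter_upwards [eventually_gt_atTop 0] with N hN
  have : (N : ℝ) ≠ 0 := by positivity
  rw [hsum, smul_add, smul_smul, inv_mul_cancel₀ this, one_smul]

theorem norm_spectralProjOne_apply_le {A : Op d} {K : ℝ} (hA : ∀ n x, ‖(A ^ n) x‖ ≤ K * ‖x‖)
    (x : V d) : ‖spectralProjOne A x‖ ≤ K * ‖x‖ := by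
  refine le_of_tendsto (tendsto_cesaro_spectralProjOne hA x).norm ?_
  filter_upwards [eventually_gt_atTop 0] with N hN
  have : (0 : ℝ) < N := by positivity
  rw [norm_smul, norm_inv, Real.norm_natCast, inv_mul_le_iff₀ this]
  calc ‖∑ k ∈ Finset.range N, (A ^ k) x‖ ≤ ∑ k ∈ Finset.range N, K * ‖x‖ :=
        norm_sum_le_of_le _ fun k _ => hA k x
    _ = N * (K * ‖x‖) := by simp
end RRDO

/-! ### The affine recursion for the process; uniform bounds and measurability. -/

namespace RRDO
variable {d : ℕ} {Ω : Type*}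

theorem IsRRDO.exists_bounds [MeasurableSpace Ω] {M : Ω → Op d} {ψS : V d} (hM : IsRRDO M ψS) :
    ∃ ν : Seminorm ℂ (V d), ∃ a > (0 : ℝ), ∃ b > (0 : ℝ),
      (∀ ω x, ν (M ω x) ≤ ν x) ∧ ∀ x, ‖x‖ ≤ a * ν x ∧ ν x ≤ b * ‖x‖ := by
  obtain ⟨ν, h0, hc⟩ := hM.contraction
  obtain ⟨a, ha, b, hb, h⟩ := exists_seminorm_equiv ν h0
  exact ⟨ν, a, ha, b, hb, hc, h⟩

theorem norm_pow_apply_le {A : Op d} {ν : Seminorm ℂ (V d)} {a b : ℝ} (ha : 0 < a)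
    (hA : ∀ x, ν (A x) ≤ ν x) (h : ∀ x, ‖x‖ ≤ a * ν x ∧ ν x ≤ b * ‖x‖) (n : ℕ) (x : V d) :
    ‖(A ^ n) x‖ ≤ a * b * ‖x‖ := by
  have h1 : ν ((A ^ n) x) ≤ ν x := by
    induction n with
    | zero => simp
    | succ n ih => rw [pow_succ', mul_apply_eq_comp]; exact (hA _).trans ih
  calc ‖(A ^ n) x‖ ≤ a * ν ((A ^ n) x) := (h _).1
    _ ≤ a * (b * ‖x‖) := by gcongr; exact h1.trans (h x).2
    _ = _ := by ring

theorem IsRRDO.exists_norm_pow_apply_le [MeasurableSpace Ω] {M : Ω → Op d} {ψS : V d}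
    (hM : IsRRDO M ψS) : ∃ K > (0 : ℝ), ∀ ω n x, ‖(M ω ^ n) x‖ ≤ K * ‖x‖ := by
  obtain ⟨ν, a, ha, b, hb, hc, h⟩ := hM.exists_bounds
  exact ⟨a * b, by positivity, fun ω n x => norm_pow_apply_le ha (hc ω) h n x⟩

section Pointwise
variable {M : Ω → Op d} {ψS : V d}

theorem inner_psi (ω : Ω) (x : V d) :
    inner ℂ (psi M ψS ω) x = inner ℂ ψS (spectralProjOne (M ω) x) :=
  ContinuousLinearMap.adjoint_inner_left _ _ _

variable [MeasurableSpace Ω]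

theorem IsRRDO.inner_invariant_psi (hM : IsRRDO M ψS) (ω : Ω) : inner ℂ (psi M ψS ω) ψS = 1 := by
  rw [inner_psi, spectralProjOne_of_fixed (hM.invariant ω), inner_self_eq_norm_sq_to_K,
    hM.norm_eq_one]
  simp

theorem IsRRDO.inner_psi_apply (hM : IsRRDO M ψS) (ω : Ω) (x : V d) :
    inner ℂ (psi M ψS ω) (M ω x) = inner ℂ (psi M ψS ω) x := by
  obtain ⟨K, -, hK⟩ := hM.exists_norm_pow_apply_le
  rw [inner_psi, inner_psi, spectralProjOne_apply_image (hK ω)]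

/-- `M P = P M = P` and `P² = P`, so `Q M Q` collapses to `M - P`. -/
theorem IsRRDO.MQ_apply (hM : IsRRDO M ψS) (ω : Ω) (x : V d) :
    MQ M ψS ω x = M ω x - (inner ℂ (psi M ψS ω) x : ℂ) • ψS := by
  simp [MQ, projP, mul_apply_eq_comp, hM.inner_psi_apply, hM.invariant,
    inner_sub_right, inner_smul_right, hM.inner_invariant_psi]

theorem IsRRDO.adjoint_MQ_apply (hM : IsRRDO M ψS) (ω : Ω) {x : V d} (hx : inner ℂ ψS x = (1 : ℂ)) :
    ContinuousLinearMap.adjoint (MQ M ψS ω) x =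
      ContinuousLinearMap.adjoint (M ω) x - psi M ψS ω := by
  refine ext_inner_right ℂ fun y => ?_
  have hx' : inner ℂ x ψS = (1 : ℂ) := by rw [← inner_conj_symm, hx, map_one]
  rw [ContinuousLinearMap.adjoint_inner_left, hM.MQ_apply, inner_sub_left,
    ContinuousLinearMap.adjoint_inner_left, inner_sub_right, inner_smul_right, hx', mul_one]

theorem IsRRDO.inner_theta (hM : IsRRDO M ψS) (w : ℕ → Ω) (n : ℕ) :
    inner ℂ ψS (theta M ψS w (n + 1)) = (1 : ℂ) := by
  induction n with
  | zero => rw [← inner_conj_symm, theta, hM.inner_invariant_psi, map_one]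
  | succ n ih => rw [theta, ContinuousLinearMap.adjoint_inner_right, hM.invariant, ih]

theorem IsRRDO.theta_succ (hM : IsRRDO M ψS) (w : ℕ → Ω) (n : ℕ) :
    theta M ψS w (n + 1) =
      ContinuousLinearMap.adjoint (MQ M ψS (w n)) (theta M ψS w n) + psi M ψS (w n) := by
  cases n with
  -- The default value `θ₀ = 0` makes the recursion hold from the start, although `⟨ψS, θ₀⟩ = 1`
  -- fails.
  | zero => simp [theta]
  | succ n => rw [theta, hM.adjoint_MQ_apply _ (hM.inner_theta w n)]; abel

theorem IsRRDO.exists_norm_theta_le (hM : IsRRDO M ψS) :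
    ∃ K, ∀ w n, ‖theta M ψS w n‖ ≤ K := by
  obtain ⟨ν, a, ha, b, hb, hc, h⟩ := hM.exists_bounds
  -- Bounding the pairing by `ν x` rather than `‖x‖` keeps the constant independent of `n`: each
  -- adjoint moves onto `x` as a `ν`-contraction. Equivalence of norms is used only for `θ₁` and, at
  -- the end, for `x = θₙ`.
  have key : ∀ w n x, ‖(inner ℂ (theta M ψS w n) x : ℂ)‖ ≤ a * b * a * ν x := by
    intro w n
    induction n with
    | zero => intro x; simp only [theta, inner_zero_left, norm_zero]; positivity
    | succ n ih =>
      intro x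
      cases n with
      | zero =>
        rw [theta, inner_psi]
        calc ‖inner ℂ ψS (spectralProjOne (M (w 0)) x)‖
            ≤ ‖ψS‖ * ‖spectralProjOne (M (w 0)) x‖ := norm_inner_le_norm _ _
          _ ≤ 1 * (a * b * ‖x‖) := by
            rw [hM.norm_eq_one]
            gcongr
            exact norm_spectralProjOne_apply_le (fun n y => norm_pow_apply_le ha (hc _) h n y) x
          _ ≤ 1 * (a * b * (a * ν x)) := by gcongr; exact (h x).1
          _ = _ := by ring
      | succ n =>
        rw [theta, ContinuousLinearMap.adjoint_inner_left]
        exact (ih _).trans (by gcongr; exact hc _ _)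
  refine ⟨a * b * a * b, fun w n => ?_⟩
  by_cases h0 : ‖theta M ψS w n‖ = 0
  · rw [h0]; positivity
  have h1 := (key w n (theta M ψS w n)).trans
    (mul_le_mul_of_nonneg_left (h (theta M ψS w n)).2 (by positivity))
  rw [inner_self_eq_norm_sq_to_K, norm_pow, RCLike.norm_ofReal, abs_norm, sq, ← mul_assoc] at h1
  exact le_of_mul_le_mul_right h1 ((norm_nonneg _).lt_of_ne' h0)

theorem IsRRDO.exists_norm_psi_le (hM : IsRRDO M ψS) : ∃ K, ∀ ω, ‖psi M ψS ω‖ ≤ K := by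
  obtain ⟨K, hK⟩ := hM.exists_norm_theta_le
  exact ⟨K, fun ω => hK (fun _ => ω) 1⟩

theorem IsRRDO.exists_norm_MQ_le (hM : IsRRDO M ψS) : ∃ K, ∀ ω, ‖MQ M ψS ω‖ ≤ K := by
  obtain ⟨K, hK0, hK⟩ := hM.exists_norm_pow_apply_le
  obtain ⟨K', hK'⟩ := hM.exists_norm_psi_le
  have h0 : 0 ≤ K + |K'| := by positivity
  refine ⟨K + |K'|, fun ω => ContinuousLinearMap.opNorm_le_bound _ h0 fun x => ?_⟩
  rw [hM.MQ_apply]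
  calc _ ≤ ‖M ω x‖ + ‖(inner ℂ (psi M ψS ω) x : ℂ) • ψS‖ := norm_sub_le _ _
    _ ≤ K * ‖x‖ + |K'| * ‖x‖ := by
      rw [norm_smul, hM.norm_eq_one, mul_one]
      gcongr
      · simpa using hK ω 1 x
      · exact (norm_inner_le_norm _ _).trans (by gcongr; exact (hK' ω).trans (le_abs_self _))
    _ = _ := by ring

theorem IsRRDO.measurable_pow (hM : IsRRDO M ψS) (n : ℕ) : Measurable fun ω => M ω ^ n :=
  (continuous_pow n).measurable.comp hM.measurable

theorem measurable_clm_apply {A : Ω → Op d} {x : Ω → V d} (hA : Measurable A)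
    (hx : Measurable x) : Measurable fun ω => A ω (x ω) :=
  (isBoundedBilinearMap_apply (𝕜 := ℂ) (E := V d) (F := V d)).continuous.measurable.comp
    (hA.prodMk hx)

/-- The projection is a pointwise limit of polynomials in `M ω`, which are measurable. -/
theorem IsRRDO.measurable_psi (hM : IsRRDO M ψS) : Measurable (psi M ψS) := by
  obtain ⟨K, -, hK⟩ := hM.exists_norm_pow_apply_le
  have hP : ∀ x, Measurable fun ω => spectralProjOne (M ω) x := fun x =>
    measurable_of_tendsto_metrizable
      (f := fun N ω => (N : ℝ)⁻¹ • ∑ k ∈ Finset.range N, (M ω ^ k) x)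
      (fun N => by
        have h : Measurable fun ω => ∑ k ∈ Finset.range N, (M ω ^ k) x :=
          Finset.measurable_fun_sum _ fun k _ =>
            measurable_clm_apply (hM.measurable_pow k) measurable_const
        exact h.const_smul (N : ℝ)⁻¹)
      (tendsto_pi_nhds.2 fun ω => tendsto_cesaro_spectralProjOne (hK ω) x)
  have hcoord : ∀ ω i, psi M ψS ω i =
      inner ℂ (spectralProjOne (M ω) (EuclideanSpace.single i 1)) ψS := by
    intro ω i
    rw [← inner_conj_symm, ← inner_psi, inner_conj_symm]
    simp [EuclideanSpace.inner_single_left]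
  have : psi M ψS = fun ω => WithLp.toLp 2 fun i =>
      inner ℂ (spectralProjOne (M ω) (EuclideanSpace.single i 1)) ψS := by
    ext ω i
    exact hcoord ω i
  rw [this]
  refine (PiLp.continuous_toLp 2 _).measurable.comp (measurable_pi_lambda _ fun i => ?_)
  exact (hP _).inner measurable_const

theorem measurable_adjoint {A : Ω → Op d} (hA : Measurable A) :
    Measurable fun ω => ContinuousLinearMap.adjoint (A ω) :=
  (ContinuousLinearMap.adjoint (𝕜 := ℂ) (E := V d) (F := V d)).continuous.measurable.comp hA

theorem IsRRDO.measurable_MQ (hM : IsRRDO M ψS) : Measurable (MQ M ψS) := by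
  have hP : Measurable (projP M ψS) :=
    ((InnerProductSpace.rankOne ℂ (E := V d) (F := V d)) ψS).continuous.measurable.comp
      hM.measurable_psi
  exact ((measurable_const.sub hP).mul hM.measurable).mul (measurable_const.sub hP)

end Pointwise
end RRDO

/-! ### A strong law for bounded orthogonal increments. -/

namespace RRDO

open ProbabilityTheory

theorem norm_sum_range_le {Ω E : Type*} [NormedAddCommGroup E] {D : ℕ → Ω → E} {K : ℝ} (hK : ∀ n w, ‖D n w‖ ≤ K) (N : ℕ) (w : Ω) :
    ‖∑ k ∈ Finset.range N, D k w‖ ≤ N * K :=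
  (norm_sum_le_of_le _ fun k _ => hK k w).trans (by simp)

section LLN
variable {Ω : Type*} [MeasurableSpace Ω] {μ : Measure Ω} [IsProbabilityMeasure μ]
  {E : Type*} [NormedAddCommGroup E] [InnerProductSpace ℂ E]

/-- Pythagoras: each new increment is orthogonal to the preceding partial sum, so the cross terms
integrate to zero. -/
theorem integral_norm_sq_sum_le {D : ℕ → Ω → E} {K : ℝ}
    (hD : ∀ n, AEStronglyMeasurable (D n) μ) (hK : ∀ n w, ‖D n w‖ ≤ K)
    (horth : ∀ n, ∫ w, inner ℂ (∑ k ∈ Finset.range n, D k w) (D n w) ∂μ = 0) (N : ℕ) :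
    ∫ w, ‖∑ k ∈ Finset.range N, D k w‖ ^ 2 ∂μ ≤ N * K ^ 2 := by
  have hS : ∀ n, AEStronglyMeasurable (fun w => ∑ k ∈ Finset.range n, D k w) μ := fun n =>
    Finset.aestronglyMeasurable_fun_sum _ fun k _ => hD k
  have hK2 : ∀ n w, ‖D n w‖ ^ 2 ≤ K ^ 2 := fun n w => by gcongr; exact hK n w
  have hI2 : ∀ n, Integrable (fun w => ‖D n w‖ ^ 2) μ := fun n =>
    .of_bound ((hD n).norm.pow 2) (K ^ 2) (.of_forall fun w => by simpa using hK2 n w)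
  have hI1 : ∀ n, Integrable (fun w => ‖∑ k ∈ Finset.range n, D k w‖ ^ 2) μ := fun n =>
    .of_bound ((hS n).norm.pow 2) ((n * K) ^ 2) (.of_forall fun w => by
      rw [norm_pow, norm_norm]; gcongr; exact norm_sum_range_le hK n w)
  have hI3 : ∀ n, Integrable (fun w => (inner ℂ (∑ k ∈ Finset.range n, D k w) (D n w) : ℂ)) μ :=
    fun n => .of_bound ((hS n).inner (hD n)) (n * K * K) (.of_forall fun w =>
      (norm_inner_le_norm _ _).trans (mul_le_mul (norm_sum_range_le hK n w) (hK n w)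
        (norm_nonneg _) ((norm_nonneg _).trans (norm_sum_range_le hK n w))))
  induction N with
  | zero => simp
  | succ N ih =>
    have hexp : ∀ w, ‖∑ k ∈ Finset.range (N + 1), D k w‖ ^ 2 =
        ‖∑ k ∈ Finset.range N, D k w‖ ^ 2
          + 2 * RCLike.re (inner ℂ (∑ k ∈ Finset.range N, D k w) (D N w) : ℂ)
          + ‖D N w‖ ^ 2 := fun w => by
      rw [Finset.sum_range_succ, norm_add_sq (𝕜 := ℂ)]
    have hre : ∫ w, RCLike.re (inner ℂ (∑ k ∈ Finset.range N, D k w) (D N w) : ℂ) ∂μ = 0 := by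
      rw [integral_re (hI3 N), horth N, map_zero]
    simp_rw [hexp]
    have hI4 := (hI3 N).re.const_mul 2
    rw [integral_add (by exact (hI1 N).add hI4) (hI2 N), integral_add (hI1 N) hI4,
      integral_const_mul, hre]
    have h2 : ∫ w, ‖D N w‖ ^ 2 ∂μ ≤ K ^ 2 := by
      simpa using integral_mono (hI2 N) (integrable_const (K ^ 2)) (hK2 N)
    push_cast
    linarith

/-- Strong law of large numbers for bounded increments orthogonal to the past. -/
theorem ae_tendsto_average_of_orthogonal {D : ℕ → Ω → E} {K : ℝ}
    (hD : ∀ n, AEStronglyMeasurable (D n) μ) (hK : ∀ n w, ‖D n w‖ ≤ K)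
    (horth : ∀ n, ∫ w, inner ℂ (∑ k ∈ Finset.range n, D k w) (D n w) ∂μ = 0) :
    ∀ᵐ w ∂μ, Tendsto (fun N : ℕ => (N : ℝ)⁻¹ • ∑ k ∈ Finset.range N, D k w) atTop (𝓝 0) := by
  set S : ℕ → Ω → E := fun N w => ∑ k ∈ Finset.range N, D k w
  have hS : ∀ n, AEStronglyMeasurable (S n) μ := fun n =>
    Finset.aestronglyMeasurable_fun_sum _ fun k _ => hD k
  -- Along the squares the second moments are at most `K² / k²`, hence summable, so `∑ F k w` is
  -- almost surely finite and its terms tend to 0.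
  set F : ℕ → Ω → ℝ := fun k w => (‖S (k ^ 2) w‖ / (k : ℝ) ^ 2) ^ 2
  have hF0 : ∀ k w, 0 ≤ F k w := fun k w => sq_nonneg _
  have hFm : ∀ k, AEStronglyMeasurable (F k) μ := fun k =>
    by
    simp only [F, div_eq_mul_inv]
    exact ((hS _).norm.mul_const _).pow 2
  have hFle : ∀ k w, F k w ≤ K ^ 2 := fun k w => by
    have h := norm_sum_range_le hK (k ^ 2) w
    rcases Nat.eq_zero_or_pos k with rfl | hk
    · simp [F]; positivity
    · have : (0 : ℝ) < (k : ℝ) ^ 2 := by positivity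
      have h' : ‖S (k ^ 2) w‖ / (k : ℝ) ^ 2 ≤ K := by
        rw [div_le_iff₀ this]; push_cast at h; linarith
      exact pow_le_pow_left₀ (by positivity) h' 2
  have hFi : ∀ k, Integrable (F k) μ := fun k =>
    .of_bound (hFm k) (K ^ 2) (.of_forall fun w => by
      rw [Real.norm_of_nonneg (hF0 k w)]; exact hFle k w)
  have hFint : ∀ k, ∫ w, F k w ∂μ ≤ K ^ 2 * ((k : ℝ) ^ 2)⁻¹ := fun k => by
    have h := integral_norm_sq_sum_le hD hK horth (k ^ 2)
    simp only [F, div_pow]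
    rw [integral_div]
    rcases Nat.eq_zero_or_pos k with rfl | hk
    · simp
    · have : (0 : ℝ) < (k : ℝ) ^ 2 := by positivity
      rw [div_le_iff₀ (by positivity)]
      push_cast at h
      refine h.trans (le_of_eq ?_)
      field_simp
  have hsum : ∑' k, ∫⁻ w, ENNReal.ofReal (F k w) ∂μ ≠ ⊤ := by
    have hs : Summable fun k : ℕ => K ^ 2 * ((k : ℝ) ^ 2)⁻¹ :=
      (Real.summable_nat_pow_inv.2 one_lt_two).mul_left _
    refine ne_top_of_le_ne_top hs.tsum_ofReal_ne_top (ENNReal.tsum_le_tsum fun k => ?_)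
    rw [← ofReal_integral_eq_lintegral_ofReal (hFi k) (.of_forall (hF0 k))]
    exact ENNReal.ofReal_le_ofReal (hFint k)
  have hmeas : ∀ k, AEMeasurable (fun w => ENNReal.ofReal (F k w)) μ := fun k =>
    (hFm k).aemeasurable.ennreal_ofReal
  rw [← lintegral_tsum hmeas] at hsum
  filter_upwards [ae_lt_top' (AEMeasurable.tsum hmeas) hsum] with w hw
  have h1 : Tendsto (fun k => F k w) atTop (𝓝 0) := by
    have := (ENNReal.tendsto_toReal ENNReal.zero_ne_top).comp
      (ENNReal.tendsto_atTop_zero_of_tsum_ne_top hw.ne)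
    simpa [Function.comp_def, ENNReal.toReal_ofReal (hF0 _ w)] using this
  have h2 : Tendsto (fun k : ℕ => ‖S (k ^ 2) w‖ / (k : ℝ) ^ 2) atTop (𝓝 0) := by
    have := h1.sqrt
    simp only [F, Real.sqrt_zero] at this
    exact this.congr fun k => Real.sqrt_sq (by positivity)
  have h3 : Tendsto (fun k : ℕ => ‖S (k ^ 2) w‖ / (k : ℝ) ^ 2 + 2 * K * (k : ℝ)⁻¹) atTop (𝓝 0) := by
    simpa using h2.add ((tendsto_inv_atTop_nhds_zero_nat (𝕜 := ℝ)).const_mul (2 * K))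
  have hsq : Tendsto Nat.sqrt atTop atTop :=
    tendsto_atTop_atTop.2 fun b => ⟨b ^ 2, fun n hn => Nat.le_sqrt'.2 hn⟩
  have hK0 : 0 ≤ K := (norm_nonneg _).trans (hK 0 w)
  refine squeeze_zero_norm' ?_ (h3.comp hsq)
  filter_upwards [eventually_gt_atTop 0] with N hN
  -- Between consecutive squares at most `2 k` increments are added, which costs `2 K / k` after
  -- division by `k²`.
  set k := Nat.sqrt N
  have hk : 0 < k := Nat.sqrt_pos.2 hN
  have hkN : k ^ 2 ≤ N := Nat.sqrt_le' N
  have hNk : N ≤ k ^ 2 + 2 * k := by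
    have := Nat.sqrt_le_add N
    simp only [k]; nlinarith
  have hkR : (0 : ℝ) < k := by positivity
  have hkN' : (k : ℝ) ^ 2 ≤ N := by exact_mod_cast hkN
  have hNk' : (N : ℝ) - k ^ 2 ≤ 2 * k := by
    have : (N : ℝ) ≤ k ^ 2 + 2 * k := by exact_mod_cast hNk
    linarith
  have hdiff : ‖S N w - S (k ^ 2) w‖ ≤ 2 * k * K := by
    simp only [S]
    rw [← Finset.sum_Ico_eq_sub _ hkN]
    calc _ ≤ ∑ i ∈ Finset.Ico (k ^ 2) N, K := norm_sum_le_of_le _ fun i _ => hK i w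
      _ = ((N : ℝ) - k ^ 2) * K := by simp [Nat.cast_sub hkN]
      _ ≤ _ := by gcongr
  have hSN : ‖S N w‖ ≤ ‖S (k ^ 2) w‖ + 2 * k * K := by
    have := norm_add_le (S (k ^ 2) w) (S N w - S (k ^ 2) w)
    rw [add_sub_cancel] at this
    linarith
  simp only [Function.comp_apply]
  change ‖(N : ℝ)⁻¹ • S N w‖ ≤ _
  rw [norm_smul, norm_inv, Real.norm_natCast]
  calc (N : ℝ)⁻¹ * ‖S N w‖ ≤ ((k : ℝ) ^ 2)⁻¹ * (‖S (k ^ 2) w‖ + 2 * k * K) := by gcongr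
    _ = ‖S (k ^ 2) w‖ / (k : ℝ) ^ 2 + 2 * K * (k : ℝ)⁻¹ := by
      generalize ‖S (k ^ 2) w‖ = s
      clear_value k
      field_simp

end LLN

/-! ### Independence of a coordinate from the preceding ones. -/

section Independence
variable {Ω : Type*} [MeasurableSpace Ω] (p : Measure Ω) [IsProbabilityMeasure p]

instance : IsProbabilityMeasure (iidMeasure p) := by unfold iidMeasure; infer_instance

/-- If `X` is a function of the coordinates `< n` and `f x` is centred for all `x`, then
`f X (w n)` is centred. -/
theorem integral_eq_zero_of_dependsOn {α F : Type*} [MeasurableSpace α] [NormedAddCommGroup F]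
    [NormedSpace ℝ F] {n : ℕ} {X : (ℕ → Ω) → α} (hX : Measurable X)
    (hdep : ∀ w w' : ℕ → Ω, (∀ i < n, w i = w' i) → X w = X w') {f : α → Ω → F}
    (hf : StronglyMeasurable (Function.uncurry f))
    (hint : Integrable (fun w => f (X w) (w n)) (iidMeasure p))
    (hzero : ∀ x, ∫ ω, f x ω ∂p = 0) :
    ∫ w, f (X w) (w n) ∂(iidMeasure p) = 0 := by
  obtain ⟨ω₀⟩ := nonempty_of_isProbabilityMeasure p
  have hindep : IndepFun X (fun w : ℕ → Ω => w n) (iidMeasure p) := by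
    have h := (iIndepFun_infinitePi (P := fun _ : ℕ => p) (X := fun _ ω => ω)
      (fun _ => measurable_id)).indepFun_finset (Finset.range n) {n} (by simp) (by fun_prop)
    -- Padding with an arbitrary point `ω₀` writes `X` as a function of finitely many coordinates.
    let ext : ((Finset.range n) → Ω) → ℕ → Ω := fun z i =>
      if h : i ∈ Finset.range n then z ⟨i, h⟩ else ω₀
    have hext : Measurable ext := by
      refine measurable_pi_lambda _ fun i => ?_
      by_cases h : i ∈ Finset.range n
      · simp only [ext, h, dif_pos]; exact measurable_pi_apply _
      · simp only [ext, h, dif_neg, not_false_eq_true]; exact measurable_const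
    have hψ : Measurable fun z : (({n} : Finset ℕ) → Ω) => z ⟨n, by simp⟩ :=
      measurable_pi_apply _
    have h' := h.comp (φ := fun z => X (ext z)) 
      (ψ := fun z : (({n} : Finset ℕ) → Ω) => z ⟨n, by simp⟩) (hX.comp hext) hψ
    refine h'.congr (.of_forall fun w => ?_) (.of_forall fun w => rfl)
    refine (hdep _ _ fun i hi => ?_)
    simp [ext, hi]
  have hmap := (indepFun_iff_map_prod_eq_prod_map_map hX.aemeasurable
    (measurable_pi_apply n).aemeasurable).1 hindep
  have hp : (iidMeasure p).map (fun w : ℕ → Ω => w n) = p :=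
    Measure.infinitePi_map_eval (fun _ => p) n
  rw [hp] at hmap
  have hpair : Measurable fun w : ℕ → Ω => (X w, w n) := hX.prodMk (measurable_pi_apply n)
  have hint' : Integrable (Function.uncurry f) (((iidMeasure p).map X).prod p) := by
    rw [← hmap, integrable_map_measure hf.aestronglyMeasurable hpair.aemeasurable]
    exact hint
  have : IsProbabilityMeasure ((iidMeasure p).map X) :=
    Measure.isProbabilityMeasure_map hX.aemeasurable
  calc ∫ w, f (X w) (w n) ∂(iidMeasure p)
      = ∫ z, Function.uncurry f z ∂((iidMeasure p).map fun w => (X w, w n)) :=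
        (integral_map hpair.aemeasurable hf.aestronglyMeasurable).symm
    _ = ∫ x, ∫ ω, f x ω ∂p ∂((iidMeasure p).map X) := by
        rw [hmap, integral_prod _ hint']; rfl
    _ = 0 := by simp [hzero]

end Independence
end RRDO

/-! ### Powers of the mean operator, invertibility, and the martingale increments. -/

namespace RRDO
variable {d : ℕ} {Ω : Type*} {M : Ω → Op d} {ψS : V d}

theorem theta_congr {n : ℕ} {w w' : ℕ → Ω} (h : ∀ i < n, w i = w' i) :
    theta M ψS w n = theta M ψS w' n := by
  induction n with
  | zero => rfl
  | succ n ih =>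
    cases n with
    | zero => simp only [theta, h 0 one_pos]
    | succ n =>
      simp only [theta, h (n + 1) (Nat.lt_succ_self _),
        ih fun i hi => h i (hi.trans (Nat.lt_succ_self _))]

theorem prodMQ_succ (n : ℕ) (w : ℕ → Ω) :
    prodMQ M ψS (n + 1) w = prodMQ M ψS n w * MQ M ψS (w n) := by
  rw [prodMQ, List.ofFn_succ']
  simp [prodMQ, List.concat_eq_append]

theorem prodMQ_congr {n : ℕ} {w w' : ℕ → Ω} (h : ∀ i < n, w i = w' i) :
    prodMQ M ψS n w = prodMQ M ψS n w' := by
  induction n with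
  | zero => simp [prodMQ]
  | succ n ih =>
    rw [prodMQ_succ, prodMQ_succ, h n n.lt_succ_self, ih fun i hi => h i (hi.trans n.lt_succ_self)]

variable [MeasurableSpace Ω]

theorem IsRRDO.measurable_prodMQ (hM : IsRRDO M ψS) (n : ℕ) : Measurable (prodMQ M ψS n) := by
  induction n with
  | zero => exact measurable_const
  | succ n ih =>
    have : prodMQ M ψS (n + 1) = fun w => prodMQ M ψS n w * MQ M ψS (w n) :=
      funext fun w => prodMQ_succ n w
    rw [this]
    exact ih.mul (hM.measurable_MQ.comp (measurable_pi_apply n))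

theorem IsRRDO.measurable_theta (hM : IsRRDO M ψS) (n : ℕ) :
    Measurable fun w => theta M ψS w n := by
  induction n with
  | zero => exact measurable_const
  | succ n ih =>
    simp_rw [hM.theta_succ]
    exact (measurable_clm_apply (measurable_adjoint (hM.measurable_MQ.comp (measurable_pi_apply n)))
      ih).add (hM.measurable_psi.comp (measurable_pi_apply n))

variable (p : Measure Ω)

/-- The centred one-step noise `M_Q(ω)^* x - E[M_Q^*] x`. -/
noncomputable def noiseMQ (M : Ω → Op d) (ψS : V d) (x : V d) (ω : Ω) : V d :=
  ContinuousLinearMap.adjoint (MQ M ψS ω) x - meanMQAdj p M ψS x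

theorem IsRRDO.measurable_noiseMQ (hM : IsRRDO M ψS) :
    Measurable fun z : V d × Ω => noiseMQ p M ψS z.1 z.2 :=
  (measurable_clm_apply (measurable_adjoint (hM.measurable_MQ.comp measurable_snd))
    measurable_fst).sub ((meanMQAdj p M ψS).continuous.measurable.comp measurable_fst)

theorem IsRRDO.exists_norm_noiseMQ_le (hM : IsRRDO M ψS) :
    ∃ K ≥ 0, ∀ x ω, ‖noiseMQ p M ψS x ω‖ ≤ K * ‖x‖ := by
  obtain ⟨K, hK⟩ := hM.exists_norm_MQ_le
  refine ⟨|K| + ‖meanMQAdj p M ψS‖, by positivity, fun x ω => (norm_sub_le _ _).trans ?_⟩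
  rw [add_mul]
  gcongr
  · refine ContinuousLinearMap.le_of_opNorm_le _ ?_ _
    simpa using (hK ω).trans (le_abs_self K)
  · exact ContinuousLinearMap.le_opNorm _ _

theorem IsRRDO.theta_succ_sub (hM : IsRRDO M ψS) (w : ℕ → Ω) (n : ℕ) (b : V d) :
    theta M ψS w (n + 1) - meanMQAdj p M ψS (theta M ψS w n) - b =
      noiseMQ p M ψS (theta M ψS w n) (w n) + (psi M ψS (w n) - b) := by
  rw [hM.theta_succ, noiseMQ]
  abel

variable [IsProbabilityMeasure p]

theorem IsRRDO.integrable_psi (hM : IsRRDO M ψS) : Integrable (psi M ψS) p := by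
  obtain ⟨K, hK⟩ := hM.exists_norm_psi_le
  exact .of_bound hM.measurable_psi.aestronglyMeasurable K (.of_forall hK)

theorem IsRRDO.integrable_adjoint_MQ (hM : IsRRDO M ψS) :
    Integrable (fun ω => ContinuousLinearMap.adjoint (MQ M ψS ω)) p := by
  obtain ⟨K, hK⟩ := hM.exists_norm_MQ_le
  exact .of_bound (measurable_adjoint hM.measurable_MQ).aestronglyMeasurable K
    (.of_forall fun ω => by simpa using hK ω)

theorem IsRRDO.integrable_noiseMQ (hM : IsRRDO M ψS) (x : V d) :
    Integrable (noiseMQ p M ψS x) p :=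
  ((hM.integrable_adjoint_MQ p).apply_continuousLinearMap x).sub (integrable_const _)

theorem IsRRDO.integral_noiseMQ (hM : IsRRDO M ψS) (x : V d) :
    ∫ ω, noiseMQ p M ψS x ω ∂p = 0 := by
  have h := (hM.integrable_adjoint_MQ p)
  simp only [noiseMQ]
  rw [integral_sub (h.apply_continuousLinearMap x) (integrable_const _),
    ← ContinuousLinearMap.integral_apply h x]
  simp [meanMQAdj]

/-- The mean of `M_Q(ωₙ)^* ⋯ M_Q(ω₁)^* x` is `E[M_Q^*]ⁿ x`. -/
theorem IsRRDO.integral_adjoint_prodMQ (hM : IsRRDO M ψS) (x : V d) (n : ℕ) :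
    Integrable (fun w => ContinuousLinearMap.adjoint (prodMQ M ψS n w) x) (iidMeasure p) ∧
    ∫ w, ContinuousLinearMap.adjoint (prodMQ M ψS n w) x ∂(iidMeasure p) =
      (meanMQAdj p M ψS ^ n) x := by
  induction n with
  | zero =>
    have : ContinuousLinearMap.adjoint (1 : Op d) = 1 := ContinuousLinearMap.adjoint_id
    simp [prodMQ, this]
  | succ n ih =>
    obtain ⟨K, -, hK⟩ := hM.exists_norm_noiseMQ_le p
    have hX : Measurable fun w => ContinuousLinearMap.adjoint (prodMQ M ψS n w) x :=
      measurable_clm_apply (measurable_adjoint (hM.measurable_prodMQ n)) measurable_const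
    have hN : Integrable (fun w => noiseMQ p M ψS
        (ContinuousLinearMap.adjoint (prodMQ M ψS n w) x) (w n)) (iidMeasure p) :=
      (ih.1.norm.const_mul K).mono'
        ((hM.measurable_noiseMQ p).comp (hX.prodMk (measurable_pi_apply n))).aestronglyMeasurable
        (.of_forall fun w => hK _ _)
    have hzero := integral_eq_zero_of_dependsOn p (f := noiseMQ p M ψS) hX
      (fun w w' h => by rw [prodMQ_congr h])
      (hM.measurable_noiseMQ p).stronglyMeasurable hN (hM.integral_noiseMQ p)
    have hB := (meanMQAdj p M ψS).integrable_comp ih.1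
    -- Under the adjoint the newest factor becomes outermost, so it acts on a vector independent of
    -- it; the noise part is then centred.
    have heq : (fun w => ContinuousLinearMap.adjoint (prodMQ M ψS (n + 1) w) x) = fun w =>
        noiseMQ p M ψS (ContinuousLinearMap.adjoint (prodMQ M ψS n w) x) (w n) +
          meanMQAdj p M ψS (ContinuousLinearMap.adjoint (prodMQ M ψS n w) x) := by
      funext w
      rw [prodMQ_succ, ContinuousLinearMap.mul_def, ContinuousLinearMap.adjoint_comp]
      simp [noiseMQ]
    rw [heq]
    refine ⟨hN.add hB, ?_⟩
    rw [integral_add hN hB, hzero, zero_add, ContinuousLinearMap.integral_comp_comm _ ih.1, ih.2,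
      pow_succ', mul_apply_eq_comp]

theorem IsRRDO.tendsto_meanMQAdj_pow (hM : IsRRDO M ψS) (hRE : CondRE p M ψS) (x : V d) :
    Tendsto (fun n => (meanMQAdj p M ψS ^ n) x) atTop (𝓝 0) := by
  obtain ⟨C, hC, α, hα, h⟩ := hRE
  -- (RE) speaks only of `n ≥ 1`. Both its alternatives give the bound `C`, which dominates even
  -- though `n₀` is random.
  rw [← tendsto_add_atTop_iff_nat 1]
  simp_rw [← fun n => (hM.integral_adjoint_prodMQ p x n).2]
  rw [← integral_zero (ℕ → Ω) (V d) (μ := iidMeasure p)]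
  refine tendsto_integral_of_dominated_convergence (fun _ => C * ‖x‖)
    (fun n => (hM.integral_adjoint_prodMQ p x (n + 1)).1.aestronglyMeasurable)
    (integrable_const _) (fun n => ?_) ?_
  · filter_upwards [h] with w hw
    obtain ⟨n₀, hn⟩ := hw
    obtain ⟨h1, h2⟩ := hn (n + 1) (by omega)
    refine ContinuousLinearMap.le_of_opNorm_le _ ?_ _
    rw [LinearIsometryEquiv.norm_map]
    rcases le_or_gt n₀ (n + 1) with h0 | h0
    · refine (h1 h0).trans (mul_le_of_le_one_right hC.le (Real.exp_le_one_iff.2 ?_))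
      have : (0 : ℝ) ≤ ((n + 1 : ℕ) : ℝ) := Nat.cast_nonneg _
      nlinarith
    · exact h2 h0
  · filter_upwards [h] with w hw
    obtain ⟨n₀, hn⟩ := hw
    have hexp : Tendsto (fun n : ℕ => C * Real.exp (-α * n) * ‖x‖) atTop (𝓝 0) := by
      have : Tendsto (fun n : ℕ => -α * (n : ℝ)) atTop atBot :=
        tendsto_natCast_atTop_atTop.const_mul_atTop_of_neg (by linarith)
      simpa using ((Real.tendsto_exp_atBot.comp this).const_mul C).mul_const ‖x‖
    refine squeeze_zero_norm' ?_ (hexp.comp (tendsto_add_atTop_nat 1))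
    filter_upwards [eventually_ge_atTop n₀] with n hn0
    refine ContinuousLinearMap.le_of_opNorm_le _ ?_ _
    rw [LinearIsometryEquiv.norm_map]
    exact (hn (n + 1) (by omega)).1 (by omega)

theorem IsRRDO.isUnit_one_sub_meanMQAdj (hM : IsRRDO M ψS) (hRE : CondRE p M ψS) :
    IsUnit (1 - meanMQAdj p M ψS) := by
  set B := meanMQAdj p M ψS
  rw [ContinuousLinearMap.isUnit_iff_bijective]
  have hinj : Function.Injective (1 - B : Op d) := by
    rw [injective_iff_map_eq_zero]
    intro x hx
    have hBx : B x = x := by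
      have : x - B x = 0 := by simpa using hx
      exact (sub_eq_zero.1 this).symm
    have hpow : ∀ n : ℕ, (B ^ n) x = x := fun n => by
      induction n with
      | zero => simp
      | succ n ih => rw [pow_succ, mul_apply_eq_comp, hBx, ih]
    have := hM.tendsto_meanMQAdj_pow p hRE x
    simp_rw [B] at hpow
    simp_rw [hpow] at this
    exact tendsto_nhds_unique tendsto_const_nhds this
  exact ⟨hinj, LinearMap.injective_iff_surjective (f := ((1 - B : Op d) : V d →ₗ[ℂ] V d)).1 hinj⟩

/-- The increments of the martingale part of `∑ θₙ` average out. -/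
theorem IsRRDO.ae_tendsto_average_increment (hM : IsRRDO M ψS) :
    ∀ᵐ w ∂(iidMeasure p), Tendsto (fun N : ℕ => (N : ℝ)⁻¹ • ∑ k ∈ Finset.range N,
      (theta M ψS w (k + 1) - meanMQAdj p M ψS (theta M ψS w k) - ∫ ω, psi M ψS ω ∂p))
      atTop (𝓝 0) := by
  set b := ∫ ω, psi M ψS ω ∂p
  set B := meanMQAdj p M ψS
  obtain ⟨K, hK⟩ := hM.exists_norm_theta_le
  have hmeas : ∀ k, Measurable fun w => theta M ψS w (k + 1) - B (theta M ψS w k) - b := fun k =>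
    ((hM.measurable_theta _).sub (B.continuous.measurable.comp (hM.measurable_theta k))).sub
      measurable_const
  have hbound : ∀ k w, ‖theta M ψS w (k + 1) - B (theta M ψS w k) - b‖ ≤ K + ‖B‖ * K + ‖b‖ :=
    fun k w => (norm_sub_le _ _).trans <| by
      gcongr
      refine (norm_sub_le _ _).trans ?_
      gcongr
      · exact hK _ _
      · exact B.le_opNorm_of_le (hK w k)
  refine ae_tendsto_average_of_orthogonal
    (D := fun n w => theta M ψS w (n + 1) - B (theta M ψS w n) - b)
    (fun n => (hmeas n).aestronglyMeasurable) hbound fun n => ?_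
  beta_reduce
  let g : V d × V d → Ω → ℂ := fun z ω => inner ℂ z.1 (noiseMQ p M ψS z.2 ω + (psi M ψS ω - b))
  -- The past enters only through the partial sum and `θₙ`; with these frozen, the fresh coordinate
  -- contributes a centred vector.
  let X : (ℕ → Ω) → V d × V d := fun w =>
    (∑ k ∈ Finset.range n, (theta M ψS w (k + 1) - B (theta M ψS w k) - b), theta M ψS w n)
  have hX : Measurable X :=
    (Finset.measurable_fun_sum _ fun k _ => hmeas k).prodMk (hM.measurable_theta n)
  have hg : Measurable (Function.uncurry g) := by
    have h1 : Measurable fun z : (V d × V d) × Ω => noiseMQ p M ψS z.1.2 z.2 :=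
      (hM.measurable_noiseMQ p).comp (g := fun z : V d × Ω => noiseMQ p M ψS z.1 z.2)
        (f := fun z : (V d × V d) × Ω => (z.1.2, z.2))
        ((measurable_snd.comp measurable_fst).prodMk measurable_snd)
    have h2 : Measurable fun z : (V d × V d) × Ω => psi M ψS z.2 - b :=
      (hM.measurable_psi.comp measurable_snd).sub measurable_const
    have h3 : Measurable fun z : (V d × V d) × Ω => z.1.1 := measurable_fst.comp measurable_fst
    exact h3.inner (𝕜 := ℂ) (h1.add h2)
  have heq : ∀ w, inner ℂ (∑ k ∈ Finset.range n,
      (theta M ψS w (k + 1) - B (theta M ψS w k) - b))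
      (theta M ψS w (n + 1) - B (theta M ψS w n) - b) = g (X w) (w n) := fun w => by
    simp only [g, X]
    rw [hM.theta_succ_sub p w n b]
  simp_rw [heq]
  refine integral_eq_zero_of_dependsOn p hX ?_ hg.stronglyMeasurable ?_ ?_
  · intro w w' h
    have hθ : ∀ k ≤ n, theta M ψS w k = theta M ψS w' k := fun k hk =>
      theta_congr fun i hi => h i (hi.trans_le hk)
    simp only [X, hθ n le_rfl]
    congr 1
    refine Finset.sum_congr rfl fun k hk => ?_
    rw [Finset.mem_range] at hk
    rw [hθ k hk.le, hθ (k + 1) hk]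
  · refine .of_bound (hg.comp (hX.prodMk (measurable_pi_apply n))).aestronglyMeasurable
      (n * (K + ‖B‖ * K + ‖b‖) * (K + ‖B‖ * K + ‖b‖)) (.of_forall fun w => ?_)
    rw [← heq]
    have h1 := norm_sum_range_le hbound n w
    exact (norm_inner_le_norm _ _).trans
      (mul_le_mul h1 (hbound n w) (norm_nonneg _) ((norm_nonneg _).trans h1))
  · intro z
    have h1 := hM.integrable_noiseMQ p z.2
    have h2 : Integrable (fun ω => psi M ψS ω - b) p :=
      (hM.integrable_psi p).sub (integrable_const b)
    have h3 : ∫ ω, (psi M ψS ω - b) ∂p = 0 := by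
      rw [integral_sub (hM.integrable_psi p) (integrable_const b)]
      simp [b]
    simp only [g]
    have h4 : Integrable (fun ω => noiseMQ p M ψS z.2 ω + (psi M ψS ω - b)) p := h1.add h2
    rw [integral_inner h4, integral_add h1 h2, hM.integral_noiseMQ p, h3]
    simp

end RRDO

/-! ### Conclusion: summing the recursion and inverting. -/

open RRDO in
theorem theorem3p3 {d : ℕ} {Ω : Type*} [MeasurableSpace Ω] (p : Measure Ω)
    [IsProbabilityMeasure p] (M : Ω → RRDO.Op d) (ψS : RRDO.V d)
    (hM : RRDO.IsRRDO M ψS) (hRE : RRDO.CondRE p M ψS) :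
    Integrable (RRDO.psi M ψS) p ∧
    Integrable (fun ω => ContinuousLinearMap.adjoint (RRDO.MQ M ψS ω)) p ∧
    IsUnit (1 - RRDO.meanMQAdj p M ψS) ∧
    ∀ᵐ w ∂(RRDO.iidMeasure p),
      Tendsto (fun N : ℕ => (N : ℝ)⁻¹ • ∑ n ∈ Finset.Icc 1 N, RRDO.theta M ψS w n) atTop
        (𝓝 (RRDO.thetaLim p M ψS)) := by
  have hU := hM.isUnit_one_sub_meanMQAdj p hRE
  refine ⟨hM.integrable_psi p, hM.integrable_adjoint_MQ p, hU, ?_⟩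
  obtain ⟨K, hK⟩ := hM.exists_norm_theta_le
  filter_upwards [hM.ae_tendsto_average_increment p] with w hw
  unfold RRDO.thetaLim
  set b := ∫ ω, RRDO.psi M ψS ω ∂p
  set B := RRDO.meanMQAdj p M ψS
  set R := Ring.inverse (1 - B)
  have hR : ∀ x, R ((1 - B) x) = x := fun x => by
    rw [← mul_apply_eq_comp, Ring.inverse_mul_cancel _ hU, one_apply_eq_self]
  -- The increments involve `B θ₀, …, B θ_{N-1}`; as `θ₀ = 0`, the shift to indices `1, …, N` leaves
  -- only the bounded boundary term `B θ_N`.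
  have hsum : ∀ N : ℕ, (1 - B) (∑ n ∈ Finset.Icc 1 N, RRDO.theta M ψS w n) =
      (∑ k ∈ Finset.range N, (RRDO.theta M ψS w (k + 1) - B (RRDO.theta M ψS w k) - b))
        - B (RRDO.theta M ψS w N) + (N : ℝ) • b := fun N => by
    induction N with
    | zero => simp [theta]
    | succ N ih =>
      rw [Finset.sum_Icc_succ_top (by omega), map_add, ih, Finset.sum_range_succ]
      rw [show ∀ x, (1 - B) x = x - B x from fun _ => rfl, Nat.cast_succ]
      module
  have h0 : Tendsto (fun N : ℕ => (N : ℝ)⁻¹ • B (RRDO.theta M ψS w N)) atTop (𝓝 0) := by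
    apply squeeze_zero_norm (a := fun N : ℕ => (N : ℝ)⁻¹ * (‖B‖ * K))
    · intro N
      rw [norm_smul, norm_inv, Real.norm_natCast]
      gcongr
      exact B.le_opNorm_of_le (hK w N)
    · simpa using (tendsto_inv_atTop_nhds_zero_nat (𝕜 := ℝ)).mul_const (‖B‖ * K)
  have h1 := (R.continuous.tendsto _).comp ((hw.sub h0).add_const b)
  rw [sub_zero, zero_add] at h1
  refine h1.congr' ?_
  filter_upwards [eventually_gt_atTop 0] with N hN
  have hN' : (N : ℝ) ≠ 0 := by positivity
  rw [Function.comp_apply, ← hR ((N : ℝ)⁻¹ • ∑ n ∈ Finset.Icc 1 N, RRDO.theta M ψS w n)]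
  congr 1
  rw [ContinuousLinearMap.map_smul_of_tower, hsum, smul_add, smul_sub, inv_smul_smul₀ hN']
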